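/- Let $\tau$ be in the upper half plane and let $$\theta_1(z)=\theta_1(z|\tau)=\sum_{k\in\mathbb Z}\exp\Big[2\pi i\Big(\big(z+\tfrac12\big)\big(k+\tfrac12\big)+\tfrac12\big(k+\tfrac12\big)^2\tau\Big)\Big].$$ Let $\varepsilon_1,\varepsilon_2$ be the basis of the weight space $\mathbb C\varepsilon_1\oplus\mathbb C\varepsilon_2$ of $\mathfrak{sp}(4,\mathbb C)$, with the complex bilinear form $(\varepsilon_j,\varepsilon_k)=\tfrac12\delta_{jk}$, and for weights $\lambda,p$ put $\lambda_p=(\lambda,p)$. For $\hbar\in\mathbb C$ put $$U(\lambda_p,\lambda_q)=\frac{\theta_1(2\hbar)}{\theta_1(6\hbar)}\,\frac{\theta_1(2\lambda_p+2\hbar)\,\theta_1(2\lambda_q+2\hbar)}{\theta_1(2\lambda_p)\,\theta_1(2\lambda_q)}\,\frac{\theta_1(\lambda_{p+q}-5\hbar)\,\theta_1(\lambda_{p+q}+2\hbar)}{\theta_1(\lambda_{p+q})\,\theta_1(\lambda_{p+q}+\hbar)}.$$ Then, for all $\hbar\in\mathbb C$ and all weights $\lambda$ for which none of the denominators below (including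 those in $U$) vanishes, $$\sum_{\substack{p=\pm\varepsilon_1\\ q=\pm\varepsilon_2}}U(\lambda_p,\lambda_q)-\sum_{\substack{p=\pm\varepsilon_1\\ q=\pm\varepsilon_2}}\frac{\theta_1(\lambda_{p+q}-\hbar)\,\theta_1(\lambda_{p+q}+2\hbar)}{\theta_1(\lambda_{p+q})\,\theta_1(\lambda_{p+q}+\hbar)}=K,$$ where $K$ is the constant, independent of $\lambda$, given by $$K=-\left(\frac{\theta_1(8\hbar)\,\theta_1(\hbar)}{\theta_1(6\hbar)\,\theta_1(5\hbar)}+\frac{\theta_1(5\hbar)\,\theta_1(2\hbar)}{\theta_1(4\hbar)\,\theta_1(3\hbar)}+\frac{\theta_1(6\hbar)\,\theta_1(3\hbar)}{\theta_1(5\hbar)\,\theta_1(4\hbar)}+\frac{\theta_1(4\hbar)\,\theta_1(\hbar)}{\theta_1(3\hbar)\,\theta_1(2\hbar)}\right).$$ -/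

import Mathlib

noncomputable section

namespace C2Theta

/-- The Jacobi theta function `θ₁(z | τ)`, by its defining series over the integers. -/
def theta1 (τ : UpperHalfPlane) (z : ℂ) : ℂ :=
  ∑' k : ℤ, Complex.exp (2 * Real.pi * Complex.I *
    ((z + 1 / 2) * ((k : ℂ) + 1 / 2) + 1 / 2 * ((k : ℂ) + 1 / 2) ^ 2 * (τ : ℂ)))

/-- The weight space of `sp(4, ℂ)`, in coordinates with respect to the basis `ε₁, ε₂`
(indexed here by `0, 1`). -/
abbrev Weight : Type := Fin 2 → ℂ

/-- The basis vectors: `ε 0` is `ε₁` and `ε 1` is `ε₂`. -/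
def ε (j : Fin 2) : Weight := Pi.single j 1

/-- The normalized (complex bilinear) Killing form: `(ε_j, ε_k) = δ_{jk} / 2`. -/
def form (x y : Weight) : ℂ := 1 / 2 * ∑ j : Fin 2, x j * y j

/-- The function `U(x, y)`, with step parameter `h`; it is used at `x = λ_p`, `y = λ_q`,
where `λ_{p+q} = x + y`. -/
def U (τ : UpperHalfPlane) (h x y : ℂ) : ℂ :=
  theta1 τ (2 * h) / theta1 τ (6 * h) *
    ((theta1 τ (2 * x + 2 * h) * theta1 τ (2 * y + 2 * h)) /
      (theta1 τ (2 * x) * theta1 τ (2 * y))) *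
    ((theta1 τ (x + y - 5 * h) * theta1 τ (x + y + 2 * h)) /
      (theta1 τ (x + y) * theta1 τ (x + y + h)))

/-- The constant `K`, a function of `τ` and `h` only. -/
def K (τ : UpperHalfPlane) (h : ℂ) : ℂ :=
  -(theta1 τ (8 * h) * theta1 τ h / (theta1 τ (6 * h) * theta1 τ (5 * h))
    + theta1 τ (5 * h) * theta1 τ (2 * h) / (theta1 τ (4 * h) * theta1 τ (3 * h))
    + theta1 τ (6 * h) * theta1 τ (3 * h) / (theta1 τ (5 * h) * theta1 τ (4 * h))
    + theta1 τ (4 * h) * theta1 τ h / (theta1 τ (3 * h) * theta1 τ (2 * h)))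

end C2Theta

end

/-
As functions of `x = λ_{ε₁}`, all terms of the identity have the common denominator
`θ₁(2x) ∏ θ₁(x + a) θ₁(x - a)`, where `a` runs over `y`, `y + h`, `y - h` and `y = λ_{ε₂}`. Both it
and the resulting numerator are odd theta functions of degree `10`. An odd theta function of degree
`2m + 2` is determined by its values at any `m` points in general position: the space of these
functions has dimension at most `m`, since quasi-periodicity and oddness leave only `m` free Fourier
coefficients, and Lagrange interpolation by products of theta functions shows that evaluation at the
points is onto. For `m = 4`, the numerator and the denominator both vanish at `y`, `y + h`, `y - h`,
so the combination of the two that vanishes at one further point is zero and their quotient does not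
depend on `x`. By symmetry it does not depend on `y` either, and at `(x, y) = (h, 3h)` most terms
vanish and the others add up to `K`. The argument needs `h` and `y` to avoid some further zeros of
`θ₁`; the general case follows by continuity.
-/

noncomputable section

namespace C2Theta

open Complex Filter Topology

lemma theta1_eq_jacobiTheta₂ (τ : UpperHalfPlane) (z : ℂ) :
    theta1 τ z = exp (Real.pi * I * (z + 1 / 2) + Real.pi * I * τ / 4) *
      jacobiTheta₂ (z + 1 / 2 + τ / 2) τ := by
  rw [theta1, jacobiTheta₂, ← tsum_mul_left]
  refine tsum_congr fun k => ?_
  rw [jacobiTheta₂_term, ← exp_add]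
  ring_nf

lemma differentiable_theta1 (τ : UpperHalfPlane) : Differentiable ℂ (theta1 τ) := by
  have hJ : Differentiable ℂ fun z => jacobiTheta₂ z τ :=
    fun z => differentiableAt_jacobiTheta₂_fst z τ.im_pos
  rw [funext (theta1_eq_jacobiTheta₂ τ)]
  fun_prop

@[fun_prop]
lemma continuous_theta1 (τ : UpperHalfPlane) : Continuous (theta1 τ) :=
  (differentiable_theta1 τ).continuous

lemma theta1_add_one (τ : UpperHalfPlane) (z : ℂ) : theta1 τ (z + 1) = -theta1 τ z := by
  rw [theta1_eq_jacobiTheta₂, theta1_eq_jacobiTheta₂,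
    show z + 1 + 1 / 2 + (τ : ℂ) / 2 = z + 1 / 2 + τ / 2 + 1 by ring, jacobiTheta₂_add_left,
    show Real.pi * I * (z + 1 + 1 / 2) + Real.pi * I * τ / 4 =
      (Real.pi * I * (z + 1 / 2) + Real.pi * I * τ / 4) + Real.pi * I by ring, exp_add,
    exp_pi_mul_I]
  ring

lemma theta1_add_tau (τ : UpperHalfPlane) (z : ℂ) :
    theta1 τ (z + τ) = -(exp (-(Real.pi * I * τ) - 2 * Real.pi * I * z) * theta1 τ z) := by
  rw [theta1_eq_jacobiTheta₂, theta1_eq_jacobiTheta₂,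
    show z + (τ : ℂ) + 1 / 2 + (τ : ℂ) / 2 = z + 1 / 2 + τ / 2 + τ by ring, jacobiTheta₂_add_left',
    ← mul_assoc, ← mul_assoc, ← exp_add, ← exp_add, ← neg_mul, ← exp_sub_pi_mul_I]
  ring_nf

lemma theta1_neg (τ : UpperHalfPlane) (z : ℂ) : theta1 τ (-z) = -theta1 τ z := by
  rw [theta1_eq_jacobiTheta₂, theta1_eq_jacobiTheta₂,
    show -z + 1 / 2 + (τ : ℂ) / 2 = -(z - 1 / 2 - τ / 2) by ring, jacobiTheta₂_neg_left,
    show z + 1 / 2 + (τ : ℂ) / 2 = (z - 1 / 2 - τ / 2) + 1 + τ by ring, jacobiTheta₂_add_left',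
    jacobiTheta₂_add_left, ← mul_assoc, ← exp_add, ← neg_mul, ← exp_add_pi_mul_I]
  ring_nf

lemma theta1_zero (τ : UpperHalfPlane) : theta1 τ 0 = 0 :=
  Function.Odd.map_zero (theta1_neg τ)

lemma theta1_sub_comm (τ : UpperHalfPlane) (z w : ℂ) : theta1 τ (z - w) = -theta1 τ (w - z) := by
  rw [← theta1_neg, neg_sub]

section EntireFunctions

variable {f : ℂ → ℂ}

lemma eventually_ne_zero_of_differentiable (hf : Differentiable ℂ f) (h0 : f ≠ 0) (z : ℂ) :
    ∀ᶠ w in 𝓝[≠] z, f w ≠ 0 := by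
  have ha : AnalyticOnNhd ℂ f Set.univ := Complex.analyticOnNhd_univ_iff_differentiable.mpr hf
  by_contra hfr
  refine h0 (ha.eq_of_frequently_eq analyticOnNhd_const (z₀ := z) ?_)
  simpa only [Filter.Frequently, Pi.zero_apply] using hfr

lemma eq_zero_of_forall_ofReal (hf : Differentiable ℂ f) (h0 : ∀ x : ℝ, f x = 0) : f = 0 := by
  by_contra hne
  have hreal : Tendsto ((↑) : ℝ → ℂ) (𝓝[≠] 0) (𝓝[≠] 0) :=
    continuous_ofReal.continuousWithinAt.tendsto_nhdsWithin fun x hx => by simpa using hx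
  obtain ⟨x, hx⟩ := (hreal.eventually (eventually_ne_zero_of_differentiable hf hne 0)).exists
  exact hx (h0 x)

lemma integral_add_eq_of_periodic {T : ℝ} (hf : Differentiable ℂ f) (hp : Function.Periodic f T)
    (w : ℂ) : ∫ x in (0 : ℝ)..T, f (x + w) = ∫ x in (0 : ℝ)..T, f x := by
  have shift_real : ∫ x in (0 : ℝ)..T, f (x + w) = ∫ x in (0 : ℝ)..T, f (x + w.im * I) := by
    have hper : Function.Periodic (fun x : ℝ => f (x + w.im * I)) T := fun x => by
      simp only [ofReal_add, add_right_comm _ (T : ℂ), hp _]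
    calc ∫ x in (0 : ℝ)..T, f (x + w)
        = ∫ x in (0 : ℝ)..T, f ((x + w.re : ℝ) + w.im * I) := by
          simp only [ofReal_add, add_assoc, re_add_im]
      _ = ∫ x in w.re..w.re + T, f (x + w.im * I) := by
          rw [intervalIntegral.integral_comp_add_right (fun x : ℝ => f (x + w.im * I)), zero_add,
            add_comm T]
      _ = ∫ x in (0 : ℝ)..T, f (x + w.im * I) := by
          rw [hper.intervalIntegral_add_eq w.re 0, zero_add]
  have sides_cancel : ∀ y : ℝ, f (T + y * I) = f (y * I) := fun y => by rw [add_comm, hp]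
  have rect := Complex.integral_boundary_rect_eq_zero_of_differentiableOn f 0 (T + w.im * I)
    hf.differentiableOn
  simp only [zero_im, ofReal_zero, zero_mul, add_zero, zero_re, add_re, ofReal_re, mul_re, I_re,
    mul_zero, ofReal_im, I_im, mul_one, sub_self, add_im, mul_im, zero_add, sides_cancel,
    smul_eq_mul, add_sub_cancel_right] at rect
  rw [shift_real]
  exact (sub_eq_zero.mp rect).symm

/-- The `k`-th Fourier coefficient of the restriction of `f` to the real line, meant for `f` of
period `1`. -/
def realFourierCoeff (k : ℤ) (f : ℂ → ℂ) : ℂ :=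
  ∫ x in (0 : ℝ)..1, exp (-(2 * Real.pi * I * k * x)) * f x

lemma periodic_exp_mul (hp : Function.Periodic f 1) (k : ℤ) :
    Function.Periodic (fun z => exp (-(2 * Real.pi * I * k * z)) * f z) 1 := fun z => by
  simp only [hp z]
  rw [show -(2 * Real.pi * I * k * (z + 1)) =
    -(2 * Real.pi * I * k * z) + (-k : ℤ) * (2 * Real.pi * I) by push_cast; ring,
    exp_add, exp_int_mul_two_pi_mul_I, mul_one]

lemma eq_zero_of_realFourierCoeff_eq_zero (hf : Differentiable ℂ f) (hp : Function.Periodic f 1)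
    (h0 : ∀ k, realFourierCoeff k f = 0) : f = 0 := by
  have hper : Function.Periodic (fun x : ℝ => f x) 1 := fun x => by
    simp only [ofReal_add, ofReal_one, hp _]
  have hc : Continuous fun x : ℝ => f x := hf.continuous.comp continuous_ofReal
  have : Fact ((0 : ℝ) < 1) := ⟨one_pos⟩
  let F : C(AddCircle (1 : ℝ), ℂ) := ⟨hper.lift, continuous_coinduced_dom.mpr hc⟩
  have hF : ∀ k, fourierCoeff F k = 0 := fun k => by
    rw [fourierCoeff_eq_intervalIntegral _ _ 0, zero_add, div_one, one_smul, ← h0 k,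
      realFourierCoeff]
    refine intervalIntegral.integral_congr fun x _ => ?_
    simp only [F, ContinuousMap.coe_mk, Function.Periodic.lift_coe, smul_eq_mul, fourier_coe_apply]
    push_cast
    ring_nf
  refine eq_zero_of_forall_ofReal hf fun x => ?_
  have hsum := has_pointwise_sum_fourier_series_of_summable (f := F)
    (by simp only [funext hF, summable_zero]) x
  simp only [hF, zero_smul] at hsum
  exact hsum.unique hasSum_zero

lemma realFourierCoeff_neg_of_odd (hp : Function.Periodic f 1) (ho : f.Odd) (k : ℤ) :
    realFourierCoeff (-k) f = -realFourierCoeff k f := by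
  have hper : Function.Periodic
      (fun x : ℝ => exp (-(2 * Real.pi * I * k * x)) * f x) 1 := fun x => by
    simpa only [ofReal_add, ofReal_one] using periodic_exp_mul hp k x
  calc realFourierCoeff (-k) f
      = ∫ x in (0 : ℝ)..1, -(exp (-(2 * Real.pi * I * k * (-x : ℝ))) * f (-x : ℝ)) := by
        refine intervalIntegral.integral_congr fun x _ => ?_
        simp only [ofReal_neg, ho _, Int.cast_neg]
        ring_nf
    _ = -∫ x in (-1 : ℝ)..0, exp (-(2 * Real.pi * I * k * x)) * f x := by
        rw [intervalIntegral.integral_neg, intervalIntegral.integral_comp_neg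
          (fun x : ℝ => exp (-(2 * Real.pi * I * k * x)) * f x), neg_zero]
    _ = -realFourierCoeff k f := by
        have := hper.intervalIntegral_add_eq (-1) 0
        rw [neg_add_cancel, zero_add] at this
        rw [this, realFourierCoeff]

lemma realFourierCoeff_add {g : ℂ → ℂ} (hf : Continuous f) (hg : Continuous g) (k : ℤ) :
    realFourierCoeff k (f + g) = realFourierCoeff k f + realFourierCoeff k g := by
  simp only [realFourierCoeff, Pi.add_apply, mul_add]
  exact intervalIntegral.integral_add (Continuous.intervalIntegrable (by fun_prop) _ _)
    (Continuous.intervalIntegrable (by fun_prop) _ _)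

lemma realFourierCoeff_smul (c : ℂ) (f : ℂ → ℂ) (k : ℤ) :
    realFourierCoeff k (c • f) = c * realFourierCoeff k f := by
  simp only [realFourierCoeff, Pi.smul_apply, smul_eq_mul, ← intervalIntegral.integral_const_mul,
    mul_left_comm c]

end EntireFunctions

/-- Theta functions of degree `n`: entire functions with the quasi-periodicity of a product of `n`
factors `θ₁(z + aᵢ)` with `∑ aᵢ = A`. -/
structure IsTheta (τ : UpperHalfPlane) (n : ℕ) (A : ℂ) (f : ℂ → ℂ) : Prop where
  differentiable : Differentiable ℂ f
  map_add_one : ∀ z, f (z + 1) = (-1) ^ n * f z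
  map_add_tau : ∀ z, f (z + τ) =
    (-1) ^ n * exp (-(Real.pi * I * (n * τ)) - 2 * Real.pi * I * (n * z + A)) * f z

namespace IsTheta

variable {τ : UpperHalfPlane} {n m : ℕ} {A B : ℂ} {f g : ℂ → ℂ}

lemma congr (hf : IsTheta τ n A f) (hn : n = m) (hA : A = B) : IsTheta τ m B f := hn ▸ hA ▸ hf

lemma zero : IsTheta τ n A 0 := ⟨differentiable_const 0, by simp, by simp⟩

lemma add (hf : IsTheta τ n A f) (hg : IsTheta τ n A g) : IsTheta τ n A (f + g) where
  differentiable := hf.differentiable.add hg.differentiable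
  map_add_one z := by simp only [Pi.add_apply, hf.map_add_one, hg.map_add_one, mul_add]
  map_add_tau z := by simp only [Pi.add_apply, hf.map_add_tau, hg.map_add_tau, mul_add]

lemma const_smul (c : ℂ) (hf : IsTheta τ n A f) : IsTheta τ n A (c • f) where
  differentiable := hf.differentiable.const_smul c
  map_add_one z := by simp only [Pi.smul_apply, smul_eq_mul, hf.map_add_one, mul_left_comm c]
  map_add_tau z := by simp only [Pi.smul_apply, smul_eq_mul, hf.map_add_tau, mul_left_comm c]

lemma sub (hf : IsTheta τ n A f) (hg : IsTheta τ n A g) : IsTheta τ n A (f - g) := by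
  simpa [sub_eq_add_neg] using hf.add (hg.const_smul (-1))

lemma one : IsTheta τ 0 0 1 := ⟨differentiable_const 1, by simp, by simp⟩

lemma mul (hf : IsTheta τ n A f) (hg : IsTheta τ m B g) : IsTheta τ (n + m) (A + B) (f * g) where
  differentiable := hf.differentiable.mul hg.differentiable
  map_add_one z := by
    simp only [Pi.mul_apply, hf.map_add_one, hg.map_add_one]
    ring
  map_add_tau z := by
    simp only [Pi.mul_apply, hf.map_add_tau, hg.map_add_tau]
    rw [show -(Real.pi * I * ((n + m : ℕ) * (τ : ℂ))) -
          2 * Real.pi * I * ((n + m : ℕ) * z + (A + B)) =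
        (-(Real.pi * I * (n * τ)) - 2 * Real.pi * I * (n * z + A)) +
        (-(Real.pi * I * (m * τ)) - 2 * Real.pi * I * (m * z + B)) by push_cast; ring, exp_add]
    ring

lemma prod {ι : Type*} (s : Finset ι) {d : ι → ℕ} {a : ι → ℂ} {F : ι → ℂ → ℂ}
    (hF : ∀ i ∈ s, IsTheta τ (d i) (a i) (F i)) :
    IsTheta τ (∑ i ∈ s, d i) (∑ i ∈ s, a i) (∏ i ∈ s, F i) := by
  classical
  induction s using Finset.induction_on with
  | empty => simpa using one
  | insert i s hi ih =>
    simp only [Finset.sum_insert hi, Finset.prod_insert hi]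
    exact (hF i (Finset.mem_insert_self i s)).mul
      (ih fun j hj => hF j (Finset.mem_insert_of_mem hj))

lemma comp_neg (hf : IsTheta τ n A f) : IsTheta τ n (-A) (fun z => f (-z)) where
  differentiable := hf.differentiable.comp differentiable_neg
  map_add_one z := by
    have h := hf.map_add_one (-(z + 1))
    rw [show -(z + 1) + 1 = -z by ring] at h
    rw [h, ← mul_assoc, ← mul_pow, neg_one_mul, neg_neg, one_pow, one_mul]
  map_add_tau z := by
    have h := hf.map_add_tau (-(z + τ))
    have hexp : exp (-(Real.pi * I * (n * τ)) - 2 * Real.pi * I * (n * z + -A)) *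
        exp (-(Real.pi * I * (n * τ)) - 2 * Real.pi * I * (n * (-(z + τ)) + A)) = 1 := by
      rw [← exp_add, exp_eq_one_iff]
      exact ⟨0, by push_cast; ring⟩
    have hsign : ((-1 : ℂ) ^ n) * (-1) ^ n = 1 := by simp [← mul_pow]
    rw [show -(z + (τ : ℂ)) + τ = -z by ring] at h
    rw [h]
    linear_combination (-f (-(z + τ))) * (hsign + (-1) ^ n * (-1) ^ n * hexp)

lemma periodic (hf : IsTheta τ n A f) (hn : Even n) : Function.Periodic f 1 := fun z => by
  rw [hf.map_add_one, hn.neg_one_pow, one_mul]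

lemma theta1_add (τ : UpperHalfPlane) (a : ℂ) : IsTheta τ 1 a (fun z => theta1 τ (z + a)) where
  differentiable := (differentiable_theta1 τ).comp (by fun_prop)
  map_add_one z := by rw [add_right_comm, theta1_add_one]; ring
  map_add_tau z := by
    rw [add_right_comm, theta1_add_tau]
    push_cast
    ring_nf

lemma theta1_two_mul_add (τ : UpperHalfPlane) (a : ℂ) :
    IsTheta τ 4 (2 * a) (fun z => theta1 τ (2 * z + a)) where
  differentiable := (differentiable_theta1 τ).comp (by fun_prop)
  map_add_one z := by
    rw [show 2 * (z + 1) + a = 2 * z + a + 1 + 1 by ring, theta1_add_one, theta1_add_one]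
    ring
  map_add_tau z := by
    rw [show 2 * (z + τ) + a = 2 * z + a + τ + τ by ring, theta1_add_tau, theta1_add_tau,
      mul_neg, neg_neg, ← mul_assoc, ← exp_add]
    push_cast
    ring_nf

lemma theta1_sub (τ : UpperHalfPlane) (a : ℂ) : IsTheta τ 1 (-a) (fun z => theta1 τ (z - a)) := by
  simpa only [sub_eq_add_neg] using theta1_add τ (-a)

lemma theta1_two_mul (τ : UpperHalfPlane) : IsTheta τ 4 0 (fun z => theta1 τ (2 * z)) := by
  simpa using theta1_two_mul_add τ 0

lemma realFourierCoeff_add_degree (hf : IsTheta τ n A f) (hn : Even n) (k : ℤ) :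
    realFourierCoeff k f =
      exp (-(Real.pi * I * (n * τ)) - 2 * Real.pi * I * (k * τ + A)) *
        realFourierCoeff (k + n) f := by
  have hd := hf.differentiable
  have hp := periodic_exp_mul (hf.periodic hn) k
  rw [← ofReal_one] at hp
  rw [realFourierCoeff, ← integral_add_eq_of_periodic (by fun_prop) hp τ, realFourierCoeff,
    ← intervalIntegral.integral_const_mul]
  refine intervalIntegral.integral_congr fun x _ => ?_
  simp only [hf.map_add_tau, hn.neg_one_pow, one_mul]
  rw [← mul_assoc, ← mul_assoc (exp _) (exp _), ← exp_add, ← exp_add]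
  congr 2
  push_cast
  ring

lemma realFourierCoeff_add_degree_mul_eq_zero_iff (hf : IsTheta τ n A f) (hn : Even n) (k q : ℤ) :
    realFourierCoeff (k + n * q) f = 0 ↔ realFourierCoeff k f = 0 := by
  have step : ∀ k : ℤ, realFourierCoeff (k + n) f = 0 ↔ realFourierCoeff k f = 0 := fun k => by
    simp [hf.realFourierCoeff_add_degree hn k, exp_ne_zero]
  induction q using Int.induction_on with
  | zero => simp
  | succ i ih => rwa [mul_add_one, ← add_assoc, step]
  | pred i ih => rwa [← step, mul_sub_one, add_assoc, sub_add_cancel]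

end IsTheta

/-- The space of odd theta functions of degree `n`, that is, of odd functions with the
quasi-periodicity of `∏ i, θ₁(z + aᵢ)`, `i = 1, …, n`, where `∑ aᵢ = 0`. -/
def oddTheta (τ : UpperHalfPlane) (n : ℕ) : Submodule ℂ (ℂ → ℂ) where
  carrier := {f | IsTheta τ n 0 f ∧ f.Odd}
  add_mem' hf hg := ⟨hf.1.add hg.1, hf.2.add hg.2⟩
  zero_mem' := ⟨.zero, .zero⟩
  smul_mem' c _ hf := ⟨hf.1.const_smul c, hf.2.const_smul c⟩

section OddTheta

variable {τ : UpperHalfPlane} {n m : ℕ} {f : ℂ → ℂ}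

lemma IsTheta.sub_comp_neg_mem_oddTheta (hf : IsTheta τ n 0 f) :
    (fun z => f z - f (-z)) ∈ oddTheta τ n :=
  ⟨hf.sub (hf.comp_neg.congr rfl neg_zero), fun z => by simp only [neg_neg, neg_sub]⟩

lemma realFourierCoeff_middle_eq_zero (hf : f ∈ oddTheta τ (2 * m)) :
    realFourierCoeff m f = 0 := by
  have he : Even (2 * m) := even_two_mul m
  have h := hf.1.realFourierCoeff_add_degree he (-m)
  rw [show -(m : ℤ) + (2 * m : ℕ) = m by push_cast; ring,
    realFourierCoeff_neg_of_odd (hf.1.periodic he) hf.2,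
    show -(Real.pi * I * ((2 * m : ℕ) * (τ : ℂ))) -
      2 * Real.pi * I * ((-(m : ℤ) : ℤ) * (τ : ℂ) + 0) = 0 by push_cast; ring,
    exp_zero, one_mul] at h
  exact neg_eq_self.mp h

lemma eq_zero_of_mem_oddTheta_of_realFourierCoeff (hf : f ∈ oddTheta τ (2 * m + 2))
    (h0 : ∀ j : Fin m, realFourierCoeff (j + 1) f = 0) : f = 0 := by
  have he : Even (2 * (m + 1)) := even_two_mul _
  have hθ : IsTheta τ (2 * (m + 1)) 0 f := hf.1
  have hp := hθ.periodic he
  have hneg : ∀ k, realFourierCoeff (-k) f = 0 ↔ realFourierCoeff k f = 0 := fun k => by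
    rw [realFourierCoeff_neg_of_odd hp hf.2, neg_eq_zero]
  have hpos : ∀ k : ℤ, 0 < k → k ≤ m + 1 → realFourierCoeff k f = 0 := fun k h1 h2 => by
    rcases h2.eq_or_lt with rfl | h2
    · exact_mod_cast realFourierCoeff_middle_eq_zero (m := m + 1) hf
    · obtain ⟨r, rfl⟩ : ∃ r : ℕ, k = r + 1 := ⟨(k - 1).toNat, by omega⟩
      exact h0 ⟨r, by omega⟩
  have hzero : realFourierCoeff 0 f = 0 := by
    simpa [self_eq_neg] using realFourierCoeff_neg_of_odd hp hf.2 0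
  refine eq_zero_of_realFourierCoeff_eq_zero hθ.differentiable hp fun k => ?_
  rw [← Int.bmod_add_bdiv k (2 * (m + 1)), hθ.realFourierCoeff_add_degree_mul_eq_zero_iff he]
  have hlow := Int.le_bmod (x := k) (m := 2 * (m + 1)) (by omega)
  have hup := Int.bmod_lt (x := k) (m := 2 * (m + 1)) (by omega)
  rcases lt_trichotomy (k.bmod (2 * (m + 1))) 0 with h | h | h
  · exact (hneg _).mp (hpos _ (by omega) (by omega))
  · rwa [h]
  · exact hpos _ h (by omega)

/-- The Fourier coefficients with indices `1, …, m`, which determine an odd theta function of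
degree `n = 2 * m + 2`. -/
def oddThetaCoeff (τ : UpperHalfPlane) (n m : ℕ) : oddTheta τ n →ₗ[ℂ] (Fin m → ℂ) where
  toFun f j := realFourierCoeff (j + 1) f
  map_add' f g := funext fun _ =>
    realFourierCoeff_add f.2.1.differentiable.continuous g.2.1.differentiable.continuous _
  map_smul' c f := funext fun _ => realFourierCoeff_smul c f _

lemma oddThetaCoeff_injective (τ : UpperHalfPlane) (m : ℕ) :
    Function.Injective (oddThetaCoeff τ (2 * m + 2) m) :=
  (injective_iff_map_eq_zero _).mpr fun f hf =>
    Subtype.ext (eq_zero_of_mem_oddTheta_of_realFourierCoeff f.2 (congrFun hf))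

/-- The product `θ₁(2z) ∏ θ₁(z + aᵢ) θ₁(z - aᵢ)` over `i ∈ s`: the odd theta function of degree
`2 * #s + 4` that vanishes at the points `aᵢ`, used for Lagrange interpolation. -/
def oddThetaProd {ι : Type*} (τ : UpperHalfPlane) (s : Finset ι) (a : ι → ℂ) (z : ℂ) : ℂ :=
  theta1 τ (2 * z) * ∏ i ∈ s, theta1 τ (z + a i) * theta1 τ (z - a i)

/-- The points `aᵢ` are in general position for `θ₁`: neither `2aᵢ` nor `aᵢ ± aⱼ`, `i ≠ j`, is a
zero of `θ₁`. -/
structure InGeneralPosition {ι : Type*} (τ : UpperHalfPlane) (a : ι → ℂ) : Prop where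
  two_mul_ne_zero : ∀ i, theta1 τ (2 * a i) ≠ 0
  pairwise : Pairwise fun i j => theta1 τ (a i + a j) * theta1 τ (a i - a j) ≠ 0

variable {ι : Type*} {a : ι → ℂ}

lemma oddThetaProd_mem_oddTheta (τ : UpperHalfPlane) (s : Finset ι) (a : ι → ℂ) :
    oddThetaProd τ s a ∈ oddTheta τ (2 * s.card + 4) := by
  refine ⟨?_, fun z => ?_⟩
  · have hprod := IsTheta.prod s fun i _ =>
      (IsTheta.theta1_add τ (a i)).mul (IsTheta.theta1_sub τ (a i))
    convert ((IsTheta.theta1_two_mul τ).mul hprod).congr (m := 2 * s.card + 4) (B := 0)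
      (by simp; ring) (by simp) using 1
    ext z
    simp [oddThetaProd]
  · have hfactor : ∀ i, theta1 τ (-z + a i) * theta1 τ (-z - a i) =
        theta1 τ (z + a i) * theta1 τ (z - a i) := fun i => by
      rw [show -z + a i = -(z - a i) by ring, show -z - a i = -(z + a i) by ring, theta1_neg,
        theta1_neg]
      ring
    simp only [oddThetaProd, hfactor, mul_neg, theta1_neg, neg_mul]

lemma oddThetaProd_eq_zero {s : Finset ι} {i : ι} (hi : i ∈ s) : oddThetaProd τ s a (a i) = 0 :=
  mul_eq_zero_of_right _ (Finset.prod_eq_zero hi (by simp [theta1_zero]))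

lemma oddThetaProd_ne_zero_iff {s : Finset ι} {z : ℂ} : oddThetaProd τ s a z ≠ 0 ↔
    theta1 τ (2 * z) ≠ 0 ∧ ∀ i ∈ s, theta1 τ (z + a i) * theta1 τ (z - a i) ≠ 0 := by
  rw [oddThetaProd, mul_ne_zero_iff, Finset.prod_ne_zero_iff]

lemma inGeneralPosition_cons_iff {x : ℂ} {a : Fin m → ℂ} :
    InGeneralPosition τ (Fin.cons x a : Fin (m + 1) → ℂ) ↔
      oddThetaProd τ Finset.univ a x ≠ 0 ∧ InGeneralPosition τ a := by
  have iff_and : ∀ {k : ℕ} {b : Fin k → ℂ}, InGeneralPosition τ b ↔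
      (∀ i, theta1 τ (2 * b i) ≠ 0) ∧
        Pairwise fun i j => theta1 τ (b i + b j) * theta1 τ (b i - b j) ≠ 0 :=
    ⟨fun h => ⟨h.1, h.2⟩, fun h => ⟨h.1, h.2⟩⟩
  have : Std.Symm fun i j : Fin (m + 1) =>
      theta1 τ ((Fin.cons x a : Fin (m + 1) → ℂ) i + (Fin.cons x a : Fin (m + 1) → ℂ) j) *
        theta1 τ ((Fin.cons x a : Fin (m + 1) → ℂ) i - (Fin.cons x a : Fin (m + 1) → ℂ) j) ≠ 0 :=
    ⟨fun i j h => by rwa [add_comm, theta1_sub_comm, mul_neg, neg_ne_zero]⟩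
  rw [iff_and, iff_and, pairwise_fin_succ_iff_of_isSymm, oddThetaProd_ne_zero_iff,
    Fin.forall_fin_succ]
  simp only [Fin.cons_zero, Fin.cons_succ, Finset.mem_univ, true_imp_iff]
  tauto

/-- Evaluation of odd theta functions at the points `aᵢ`. -/
def oddThetaEval (τ : UpperHalfPlane) (n : ℕ) (a : ι → ℂ) : oddTheta τ n →ₗ[ℂ] (ι → ℂ) :=
  LinearMap.funLeft ℂ ℂ a ∘ₗ (oddTheta τ n).subtype

lemma InGeneralPosition.oddThetaEval_surjective {a : Fin m → ℂ} (ha : InGeneralPosition τ a) :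
    Function.Surjective (oddThetaEval τ (2 * m + 2) a) := by
  let L : Fin m → ℂ → ℂ := fun i => oddThetaProd τ (Finset.univ.erase i) a
  have hmem : ∀ i, L i ∈ oddTheta τ (2 * m + 2) := fun i => by
    convert oddThetaProd_mem_oddTheta τ (Finset.univ.erase i) a using 2
    rw [Finset.card_erase_of_mem (Finset.mem_univ i), Finset.card_univ, Fintype.card_fin]
    have := i.pos
    omega
  have hself : ∀ i, L i (a i) ≠ 0 := fun i => oddThetaProd_ne_zero_iff.mpr
    ⟨ha.two_mul_ne_zero i, fun j hj => ha.pairwise (Finset.ne_of_mem_erase hj).symm⟩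
  have hother : ∀ j i, i ≠ j → L i (a j) = 0 := fun j i hij =>
    oddThetaProd_eq_zero (Finset.mem_erase.mpr ⟨hij.symm, Finset.mem_univ j⟩)
  refine fun v => ⟨∑ i, (v i / L i (a i)) • ⟨L i, hmem i⟩, funext fun j => ?_⟩
  rw [map_sum, Finset.sum_apply, Finset.sum_eq_single_of_mem j (Finset.mem_univ j)]
  · simp [oddThetaEval, LinearMap.funLeft_apply, hself]
  · intro i _ hij
    simp [oddThetaEval, LinearMap.funLeft_apply, hother j i hij]

lemma InGeneralPosition.eq_zero_of_mem_oddTheta {a : Fin m → ℂ} (ha : InGeneralPosition τ a)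
    (hf : f ∈ oddTheta τ (2 * m + 2)) (h0 : ∀ i, f (a i) = 0) : f = 0 := by
  have hinj : Function.Injective (oddThetaEval τ (2 * m + 2) a) :=
    OrzechProperty.injective_of_surjective_of_injective (oddThetaCoeff τ (2 * m + 2) m) _
      (oddThetaCoeff_injective τ m) ha.oddThetaEval_surjective
  exact congrArg Subtype.val ((injective_iff_map_eq_zero _).mp hinj ⟨f, hf⟩ (funext h0))

lemma InGeneralPosition.mul_oddThetaProd_comm {a : Fin m → ℂ} (ha : InGeneralPosition τ a)
    (hf : f ∈ oddTheta τ (2 * m + 4)) (h0 : ∀ i, f (a i) = 0) (z w : ℂ) :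
    f z * oddThetaProd τ Finset.univ a w = f w * oddThetaProd τ Finset.univ a z := by
  set P := oddThetaProd τ Finset.univ a with hP
  have hPmem : P ∈ oddTheta τ (2 * m + 4) := by
    simpa using oddThetaProd_mem_oddTheta τ Finset.univ a
  have of_ne_zero : ∀ z w, P w ≠ 0 → f z * P w = f w * P z := fun z w hw => by
    have hb := inGeneralPosition_cons_iff.mpr ⟨hw, ha⟩
    have hzero : P w • f - f w • P = 0 := by
      refine hb.eq_zero_of_mem_oddTheta
        (Submodule.sub_mem _ (Submodule.smul_mem _ _ hf) (Submodule.smul_mem _ _ hPmem))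
        (Fin.cases ?_ fun i => ?_)
      · simp [mul_comm]
      · simp [h0, hP, oddThetaProd_eq_zero]
    have := congrFun hzero z
    simp only [Pi.sub_apply, Pi.smul_apply, smul_eq_mul, Pi.zero_apply] at this
    linear_combination this
  by_cases hw : P w = 0
  · by_cases hz : P z = 0
    · simp [hw, hz]
    · exact (of_ne_zero w z hz).symm
  · exact of_ne_zero z w hw

end OddTheta

section SignSum

variable {τ : UpperHalfPlane} {h x y : ℂ}

/-- The summand of the second sum of the identity, at `s = λ_{p+q}`. -/
def V (τ : UpperHalfPlane) (h s : ℂ) : ℂ :=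
  theta1 τ (s - h) * theta1 τ (s + 2 * h) / (theta1 τ s * theta1 τ (s + h))

/-- The left-hand side of the identity, in the coordinates `x = λ_{ε₁}` and `y = λ_{ε₂}`. -/
def signSum (τ : UpperHalfPlane) (h x y : ℂ) : ℂ :=
  (U τ h x y - V τ h (x + y)) + (U τ h x (-y) - V τ h (x + -y)) +
    (U τ h (-x) y - V τ h (-x + y)) + (U τ h (-x) (-y) - V τ h (-x + -y))

lemma U_comm (τ : UpperHalfPlane) (h x y : ℂ) : U τ h x y = U τ h y x := by
  rw [U, U, add_comm y x, mul_comm (theta1 τ (2 * y + 2 * h)), mul_comm (theta1 τ (2 * y))]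

lemma signSum_comm (τ : UpperHalfPlane) (h x y : ℂ) : signSum τ h x y = signSum τ h y x := by
  rw [signSum, signSum, U_comm τ h x y, U_comm τ h x (-y), U_comm τ h (-x) y,
    U_comm τ h (-x) (-y), add_comm x y, add_comm x (-y), add_comm (-x) y, add_comm (-x) (-y)]
  ring

/-- The common denominator of the dependence of `U` and `V` on `s = λ_{p+q}` and on `-s`. -/
def poleFactor (τ : UpperHalfPlane) (h s : ℂ) : ℂ :=
  theta1 τ s * theta1 τ (s + h) * theta1 τ (s - h)

lemma poleFactor_neg (τ : UpperHalfPlane) (h s : ℂ) :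
    poleFactor τ h (-s) = -poleFactor τ h s := by
  rw [poleFactor, poleFactor, show -s + h = -(s - h) by ring, show -s - h = -(s + h) by ring,
    theta1_neg, theta1_neg, theta1_neg]
  ring

lemma poleFactor_ne_zero_iff {s : ℂ} : poleFactor τ h s ≠ 0 ↔
    theta1 τ s ≠ 0 ∧ theta1 τ (s + h) ≠ 0 ∧ theta1 τ (-s + h) ≠ 0 := by
  rw [poleFactor, mul_ne_zero_iff, mul_ne_zero_iff, and_assoc, neg_add_eq_sub, theta1_sub_comm τ h,
    neg_ne_zero]

lemma poleFactor_zero (τ : UpperHalfPlane) (h : ℂ) : poleFactor τ h 0 = 0 := by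
  simp [poleFactor, theta1_zero]

lemma poleFactor_self (τ : UpperHalfPlane) (h : ℂ) : poleFactor τ h h = 0 := by
  simp [poleFactor, theta1_zero]

lemma poleFactor_neg_self (τ : UpperHalfPlane) (h : ℂ) : poleFactor τ h (-h) = 0 := by
  rw [poleFactor_neg, poleFactor_self, neg_zero]

/-- A common denominator of the terms of `signSum`, as functions of `x`. -/
def den (τ : UpperHalfPlane) (h y x : ℂ) : ℂ :=
  theta1 τ (2 * x) * (poleFactor τ h (x + y) * poleFactor τ h (x - y))

lemma den_eq_oddThetaProd (τ : UpperHalfPlane) (h y : ℂ) :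
    den τ h y = oddThetaProd τ Finset.univ ![y, y + h, y - h] := by
  ext x
  simp only [den, poleFactor, oddThetaProd, Fin.prod_univ_three, Matrix.cons_val,
    ← add_assoc, ← add_sub_assoc, ← sub_sub, ← sub_add]
  ring

lemma den_neg_left (τ : UpperHalfPlane) (h y x : ℂ) : den τ h (-y) x = den τ h y x := by
  rw [den, den, sub_neg_eq_add, ← sub_eq_add_neg, mul_comm (poleFactor τ h (x - y))]

lemma den_neg_right (τ : UpperHalfPlane) (h y x : ℂ) : den τ h y (-x) = -den τ h y x := by
  rw [den, den, mul_neg, theta1_neg, show -x + y = -(x - y) by ring,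
    show -x - y = -(x + y) by ring, poleFactor_neg, poleFactor_neg]
  ring

/-- The factor of `U` that depends on `y` and `h` only. -/
def coeffU (τ : UpperHalfPlane) (h y : ℂ) : ℂ :=
  theta1 τ (2 * h) / theta1 τ (6 * h) * (theta1 τ (2 * y + 2 * h) / theta1 τ (2 * y))

/-- The numerator of `U τ h x y - V τ h (x + y)` over the denominator `den`. -/
def numTerm (τ : UpperHalfPlane) (h y x : ℂ) : ℂ :=
  (coeffU τ h y * (theta1 τ (2 * x + 2 * h) * theta1 τ (x + y - 5 * h)) -
      theta1 τ (2 * x) * theta1 τ (x + y - h)) *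
    (theta1 τ (x + y + 2 * h) * theta1 τ (x + y - h)) * poleFactor τ h (x - y)

/-- The numerator of `signSum` over the denominator `den`. -/
def num (τ : UpperHalfPlane) (h y x : ℂ) : ℂ :=
  (numTerm τ h y x - numTerm τ h y (-x)) + (numTerm τ h (-y) x - numTerm τ h (-y) (-x))

lemma sub_mul_den (hd : den τ h y x ≠ 0) :
    (U τ h x y - V τ h (x + y)) * den τ h y x = numTerm τ h y x := by
  simp only [den, poleFactor, mul_ne_zero_iff] at hd
  obtain ⟨h2x, ⟨⟨hs, hsh⟩, -⟩, -⟩ := hd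
  simp only [U, V, den, numTerm, coeffU, poleFactor]
  generalize theta1 τ (2 * h) / theta1 τ (6 * h) = c
  rw [mul_div_mul_comm]
  generalize theta1 τ (2 * y + 2 * h) / theta1 τ (2 * y) = g
  field_simp

lemma signSum_mul_den (hd : den τ h y x ≠ 0) : signSum τ h x y * den τ h y x = num τ h y x := by
  have hd' : den τ h y (-x) ≠ 0 := by rwa [den_neg_right, neg_ne_zero]
  rw [signSum, num, ← sub_mul_den hd, ← sub_mul_den hd',
    ← sub_mul_den (y := -y) (by rwa [den_neg_left]),
    ← sub_mul_den (y := -y) (by rwa [den_neg_left]), den_neg_left, den_neg_left, den_neg_right]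
  ring

lemma isTheta_numTerm (τ : UpperHalfPlane) (h y : ℂ) : IsTheta τ 10 0 (numTerm τ h y) := by
  have T := IsTheta.theta1_add τ
  have S := IsTheta.theta1_sub τ
  have hU : IsTheta τ 5 (y - h) _ := (((IsTheta.theta1_two_mul_add τ (2 * h)).mul
    (T (y - 5 * h))).const_smul (coeffU τ h y)).congr rfl (by ring)
  have hV : IsTheta τ 5 (y - h) _ :=
    ((IsTheta.theta1_two_mul τ).mul (T (y - h))).congr rfl (by ring)
  convert (((hU.sub hV).mul ((T (y + 2 * h)).mul (T (y - h)))).mul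
    (((S y).mul (T (-y + h))).mul (S (y + h)))).congr (m := 10) (B := 0) rfl (by ring) using 1
  ext x
  simp only [numTerm, poleFactor, Pi.mul_apply, Pi.sub_apply, Pi.smul_apply, smul_eq_mul]
  ring_nf

lemma num_mem_oddTheta (τ : UpperHalfPlane) (h y : ℂ) : num τ h y ∈ oddTheta τ 10 :=
  Submodule.add_mem _ (isTheta_numTerm τ h y).sub_comp_neg_mem_oddTheta
    (isTheta_numTerm τ h (-y)).sub_comp_neg_mem_oddTheta

lemma numTerm_self (τ : UpperHalfPlane) (h y : ℂ) : numTerm τ h y y = 0 := by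
  rw [numTerm, sub_self, poleFactor_zero, mul_zero]

lemma numTerm_add (τ : UpperHalfPlane) (h y : ℂ) : numTerm τ h y (y + h) = 0 := by
  rw [numTerm, add_sub_cancel_left, poleFactor_self, mul_zero]

lemma numTerm_sub (τ : UpperHalfPlane) (h y : ℂ) : numTerm τ h y (y - h) = 0 := by
  rw [numTerm, show y - h - y = -h by ring, poleFactor_neg_self, mul_zero]

lemma numTerm_neg_add (τ : UpperHalfPlane) (h y : ℂ) : numTerm τ h y (-y + h) = 0 := by
  rw [numTerm, show -y + h + y - h = 0 by ring, theta1_zero, mul_zero, mul_zero, mul_zero, zero_mul]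

lemma numTerm_neg_sub (h6 : theta1 τ (6 * h) ≠ 0) (hy : theta1 τ (2 * y) ≠ 0) :
    numTerm τ h y (-y - h) = 0 := by
  rw [numTerm, coeffU, show 2 * (-y - h) + 2 * h = -(2 * y) by ring,
    show -y - h + y - 5 * h = -(6 * h) by ring, show 2 * (-y - h) = -(2 * y + 2 * h) by ring,
    show -y - h + y - h = -(2 * h) by ring]
  simp only [theta1_neg]
  refine mul_eq_zero_of_left (mul_eq_zero_of_left ?_ _) _
  field

lemma numTerm_neg_left (hy : theta1 τ (2 * y) ≠ 0) : numTerm τ h (-y) y = numTerm τ h y (-y) := by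
  simp only [numTerm, coeffU, neg_add_cancel, add_neg_cancel, sub_neg_eq_add]
  rw [show 2 * -y + 2 * h = -(2 * y - 2 * h) by ring, mul_neg, show -y - y = -(y + y) by ring,
    poleFactor_neg, theta1_neg, theta1_neg]
  generalize theta1 τ (2 * h) / theta1 τ (6 * h) = c
  field

lemma num_self (hy : theta1 τ (2 * y) ≠ 0) : num τ h y y = 0 := by
  have hneg := numTerm_self τ h (-y)
  rw [num, numTerm_self, hneg, numTerm_neg_left hy]
  ring

lemma num_add (h6 : theta1 τ (6 * h) ≠ 0) (hy : theta1 τ (2 * y) ≠ 0) : num τ h y (y + h) = 0 := by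
  have hneg_add := numTerm_neg_add τ h (-y)
  rw [neg_neg] at hneg_add
  rw [num, numTerm_add, hneg_add, neg_add', numTerm_neg_sub h6 hy, numTerm_sub]
  ring

lemma num_sub (h6 : theta1 τ (6 * h) ≠ 0) (hy : theta1 τ (2 * y) ≠ 0) : num τ h y (y - h) = 0 := by
  have hneg_sub := numTerm_neg_sub (y := -y) h6 (by rwa [mul_neg, theta1_neg, neg_ne_zero])
  rw [neg_neg] at hneg_sub
  rw [num, numTerm_sub, hneg_sub, neg_sub', sub_neg_eq_add, numTerm_neg_add, numTerm_add]
  ring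

lemma num_mul_den_comm (ha : InGeneralPosition τ ![y, y + h, y - h]) (h6 : theta1 τ (6 * h) ≠ 0)
    (z w : ℂ) : num τ h y z * den τ h y w = num τ h y w * den τ h y z := by
  have hy := ha.two_mul_ne_zero 0
  rw [den_eq_oddThetaProd]
  refine ha.mul_oddThetaProd_comm (num_mem_oddTheta τ h y) (fun i => ?_) z w
  fin_cases i
  exacts [num_self hy, num_add h6 hy, num_sub h6 hy]

lemma inGeneralPosition_triple (h1 : theta1 τ h ≠ 0) (h2 : theta1 τ (2 * h) ≠ 0)
    (hy : ∀ n ∈ Finset.Icc (-2 : ℤ) 2, theta1 τ (2 * y + n * h) ≠ 0) :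
    InGeneralPosition τ ![y, y + h, y - h] := by
  have hy_zero : theta1 τ (2 * y) ≠ 0 := by simpa using hy 0 (by decide)
  have hy_one : theta1 τ (y + (y + h)) ≠ 0 := by
    simpa [two_mul, add_assoc] using hy 1 (by decide)
  have hy_neg_one : theta1 τ (y + (y - h)) ≠ 0 := by
    simpa [two_mul, add_sub_assoc, ← sub_eq_add_neg] using hy (-1) (by decide)
  have hy_two : theta1 τ (2 * (y + h)) ≠ 0 := by simpa [mul_add] using hy 2 (by decide)
  have hy_neg_two : theta1 τ (2 * (y - h)) ≠ 0 := by
    simpa [mul_sub, ← sub_eq_add_neg] using hy (-2) (by decide)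
  have hnil : InGeneralPosition τ (![] : Fin 0 → ℂ) := ⟨finZeroElim, finZeroElim⟩
  refine inGeneralPosition_cons_iff.mpr ⟨?_, inGeneralPosition_cons_iff.mpr
    ⟨?_, inGeneralPosition_cons_iff.mpr ⟨?_, hnil⟩⟩⟩
  · simp [oddThetaProd_ne_zero_iff, Fin.forall_fin_two, theta1_neg, *]
  · simp [oddThetaProd_ne_zero_iff, show y + h + (y - h) = 2 * y by ring,
      show y + h - (y - h) = 2 * h by ring, *]
  · simp [oddThetaProd_ne_zero_iff, *]

lemma U_neg_self (τ : UpperHalfPlane) (h z : ℂ) : U τ h (-h) z = 0 := by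
  simp [U, theta1_zero]

lemma V_neg_two_mul (τ : UpperHalfPlane) (h : ℂ) : V τ h (-(2 * h)) = 0 := by
  simp [V, theta1_zero]

lemma signSum_self_three_mul (h2 : theta1 τ (2 * h) ≠ 0) (h4 : theta1 τ (4 * h) ≠ 0)
    (h6 : theta1 τ (6 * h) ≠ 0) : signSum τ h h (3 * h) = K τ h := by
  have hU : U τ h h (3 * h) = -(theta1 τ (8 * h) * theta1 τ h /
      (theta1 τ (6 * h) * theta1 τ (5 * h))) := by
    rw [U, show 2 * h + 2 * h = 4 * h by ring, show 2 * (3 * h) + 2 * h = 8 * h by ring,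
      show 2 * (3 * h) = 6 * h by ring, show h + 3 * h - 5 * h = -h by ring,
      show h + 3 * h + 2 * h = 6 * h by ring, show h + 3 * h + h = 5 * h by ring,
      show h + 3 * h = 4 * h by ring, theta1_neg]
    field
  have hU_neg_right : U τ h h (-(3 * h)) = 0 := by
    simp [U, theta1_zero, show h + -(3 * h) + 2 * h = 0 by ring]
  have hV_four : V τ h (h + 3 * h) = theta1 τ (6 * h) * theta1 τ (3 * h) /
      (theta1 τ (5 * h) * theta1 τ (4 * h)) := by
    rw [V, show h + 3 * h - h = 3 * h by ring, show h + 3 * h + 2 * h = 6 * h by ring,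
      show h + 3 * h + h = 5 * h by ring, show h + 3 * h = 4 * h by ring, mul_comm,
      mul_comm (theta1 τ (4 * h))]
  have hV_neg_two : V τ h (h + -(3 * h)) = 0 := by
    rw [show h + -(3 * h) = -(2 * h) by ring, V_neg_two_mul]
  have hV_two : V τ h (-h + 3 * h) = theta1 τ (4 * h) * theta1 τ h /
      (theta1 τ (3 * h) * theta1 τ (2 * h)) := by
    rw [V, show -h + 3 * h - h = h by ring, show -h + 3 * h + 2 * h = 4 * h by ring,
      show -h + 3 * h + h = 3 * h by ring, show -h + 3 * h = 2 * h by ring, mul_comm,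
      mul_comm (theta1 τ (2 * h))]
  have hV_neg_four : V τ h (-h + -(3 * h)) = theta1 τ (5 * h) * theta1 τ (2 * h) /
      (theta1 τ (4 * h) * theta1 τ (3 * h)) := by
    rw [V, show -h + -(3 * h) - h = -(5 * h) by ring,
      show -h + -(3 * h) + 2 * h = -(2 * h) by ring, show -h + -(3 * h) + h = -(3 * h) by ring,
      show -h + -(3 * h) = -(4 * h) by ring, theta1_neg, theta1_neg, theta1_neg, theta1_neg,
      neg_mul_neg, neg_mul_neg]
  rw [signSum, hU, hU_neg_right, U_neg_self, U_neg_self, hV_four, hV_neg_two, hV_two,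
    hV_neg_four, K]
  ring

/-- The combinations of `h` and `y` with small integer coefficients that occur in the
interpolation argument are not zeros of `θ₁`. -/
def Generic (τ : UpperHalfPlane) (h y : ℂ) : Prop :=
  ∀ a ∈ Finset.Icc (-8 : ℤ) 8, ∀ b ∈ Finset.Icc (0 : ℤ) 2, ¬(a = 0 ∧ b = 0) →
    theta1 τ (a * h + b * y) ≠ 0

namespace Generic

protected lemma mul_ne_zero (hg : Generic τ h y) (a : ℤ) (ha : a ∈ Finset.Icc 1 8 := by decide) :
    theta1 τ (a * h) ≠ 0 := by
  simpa using hg a (Finset.Icc_subset_Icc_left (by decide) ha) 0 (by decide)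
    fun h0 => absurd (h0.1 ▸ ha) (by decide)

lemma add_ne_zero (hg : Generic τ h y) (a : ℤ) (ha : a ∈ Finset.Icc (-8) 8 := by decide) :
    theta1 τ (y + a * h) ≠ 0 := by
  simpa [add_comm] using hg a ha 1 (by decide) (by simp)

lemma two_mul_add_ne_zero (hg : Generic τ h y) (a : ℤ)
    (ha : a ∈ Finset.Icc (-8) 8 := by decide) : theta1 τ (2 * y + a * h) ≠ 0 := by
  simpa [add_comm] using hg a ha 2 (by decide) (by simp)

lemma poleFactor_add_ne_zero (hg : Generic τ h y) (a : ℤ)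
    (ha : a ∈ Finset.Icc (-7) 7 := by decide) : poleFactor τ h (y + a * h) ≠ 0 := by
  rw [Finset.mem_Icc] at ha
  have hsucc := hg.add_ne_zero (a + 1) (by rw [Finset.mem_Icc]; omega)
  have hpred := hg.add_ne_zero (a - 1) (by rw [Finset.mem_Icc]; omega)
  push_cast at hsucc hpred
  rw [poleFactor, mul_ne_zero_iff, mul_ne_zero_iff, add_assoc, add_sub_assoc, ← add_one_mul,
    ← sub_one_mul]
  exact ⟨⟨hg.add_ne_zero a (by rw [Finset.mem_Icc]; omega), hsucc⟩, hpred⟩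

lemma poleFactor_mul_ne_zero (hg : Generic τ h y) (a : ℤ)
    (ha : a ∈ Finset.Icc 2 7 := by decide) : poleFactor τ h (a * h) ≠ 0 := by
  rw [Finset.mem_Icc] at ha
  have hsucc := hg.mul_ne_zero (a + 1) (by rw [Finset.mem_Icc]; omega)
  have hpred := hg.mul_ne_zero (a - 1) (by rw [Finset.mem_Icc]; omega)
  push_cast at hsucc hpred
  rw [poleFactor, mul_ne_zero_iff, mul_ne_zero_iff, ← add_one_mul, ← sub_one_mul]
  exact ⟨⟨hg.mul_ne_zero a (by rw [Finset.mem_Icc]; omega), hsucc⟩, hpred⟩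

lemma inGeneralPosition (hg : Generic τ h y) : InGeneralPosition τ ![y, y + h, y - h] :=
  inGeneralPosition_triple (by simpa using hg.mul_ne_zero 1) (hg.mul_ne_zero 2) fun n hn =>
    hg.two_mul_add_ne_zero n (Finset.Icc_subset_Icc (by decide) (by decide) hn)

lemma inGeneralPosition_three_mul (hg : Generic τ h y) :
    InGeneralPosition τ ![3 * h, 3 * h + h, 3 * h - h] :=
  inGeneralPosition_triple (by simpa using hg.mul_ne_zero 1) (hg.mul_ne_zero 2) fun n hn => by
    rw [← mul_assoc, ← add_mul]
    exact_mod_cast hg.mul_ne_zero (2 * 3 + n) (by rw [Finset.mem_Icc] at hn ⊢; omega)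

lemma den_three_mul_left_ne_zero (hg : Generic τ h y) : den τ h (3 * h) y ≠ 0 := by
  rw [den, mul_ne_zero_iff, mul_ne_zero_iff]
  exact ⟨by simpa using hg.two_mul_add_ne_zero 0, hg.poleFactor_add_ne_zero 3,
    by simpa [sub_eq_add_neg] using hg.poleFactor_add_ne_zero (-3)⟩

lemma den_three_mul_right_ne_zero (hg : Generic τ h y) : den τ h y (3 * h) ≠ 0 := by
  rw [den, mul_ne_zero_iff, mul_ne_zero_iff, add_comm, ← neg_sub y, poleFactor_neg, neg_ne_zero,
    ← mul_assoc]
  exact ⟨by norm_num1; exact hg.mul_ne_zero 6, hg.poleFactor_add_ne_zero 3,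
    by simpa [sub_eq_add_neg] using hg.poleFactor_add_ne_zero (-3)⟩

lemma den_three_mul_self_ne_zero (hg : Generic τ h y) : den τ h (3 * h) h ≠ 0 := by
  rw [den, show h + 3 * h = (4 : ℤ) * h by push_cast; ring,
    show h - 3 * h = -((2 : ℤ) * h) by push_cast; ring, poleFactor_neg]
  exact mul_ne_zero (hg.mul_ne_zero 2) (mul_ne_zero (hg.poleFactor_mul_ne_zero 4)
    (neg_ne_zero.mpr (hg.poleFactor_mul_ne_zero 2)))

lemma signSum_three_mul (hg : Generic τ h y) : signSum τ h (3 * h) y = K τ h := by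
  have h6 : theta1 τ (6 * h) ≠ 0 := hg.mul_ne_zero 6
  have hd := hg.den_three_mul_left_ne_zero
  have hd_self := hg.den_three_mul_self_ne_zero
  rw [signSum_comm]
  refine mul_right_cancel₀ (mul_ne_zero hd hd_self) ?_
  calc signSum τ h y (3 * h) * (den τ h (3 * h) y * den τ h (3 * h) h)
      = num τ h (3 * h) y * den τ h (3 * h) h := by rw [← signSum_mul_den hd, mul_assoc]
    _ = num τ h (3 * h) h * den τ h (3 * h) y :=
      num_mul_den_comm hg.inGeneralPosition_three_mul h6 y h
    _ = signSum τ h h (3 * h) * (den τ h (3 * h) y * den τ h (3 * h) h) := by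
      rw [← signSum_mul_den hd_self, mul_right_comm, mul_assoc]
    _ = K τ h * (den τ h (3 * h) y * den τ h (3 * h) h) := by
      rw [signSum_self_three_mul (hg.mul_ne_zero 2) (hg.mul_ne_zero 4) h6]

lemma num_eq_K_mul_den (hg : Generic τ h y) (x : ℂ) : num τ h y x = K τ h * den τ h y x := by
  have hd := hg.den_three_mul_right_ne_zero
  refine mul_right_cancel₀ hd ?_
  rw [num_mul_den_comm hg.inGeneralPosition (hg.mul_ne_zero 6), ← signSum_mul_den hd,
    hg.signSum_three_mul, mul_right_comm]

end Generic

lemma eventually_theta1_ne_zero {w k : ℂ} (hw : theta1 τ w ≠ 0) (hk : k ≠ 0) (u : ℂ) :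
    ∀ᶠ t in 𝓝[≠] (0 : ℂ), theta1 τ (u + k * t) ≠ 0 := by
  have hd := differentiable_theta1 τ
  refine eventually_ne_zero_of_differentiable (f := fun t => theta1 τ (u + k * t)) (by fun_prop)
    (fun h0 => hw ?_) 0
  simpa [mul_div_cancel₀ _ hk] using congrFun h0 ((w - u) / k)

-- The slope `9` makes `a + 9 * b` nonzero for all `|a| ≤ 8` and `b ≠ 0`.
lemma eventually_generic {w : ℂ} (hw : theta1 τ w ≠ 0) (h y : ℂ) :
    ∀ᶠ t in 𝓝[≠] (0 : ℂ), Generic τ (h + t) (y + 9 * t) := by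
  refine (eventually_all_finset _).mpr fun a ha => (eventually_all_finset _).mpr fun b hb => ?_
  rw [Finset.mem_Icc] at ha hb
  refine eventually_imp_distrib_left.mpr fun h0 => ?_
  have hk : ((a + 9 * b : ℤ) : ℂ) ≠ 0 := Int.cast_ne_zero.mpr (by omega)
  filter_upwards [eventually_theta1_ne_zero hw hk (a * h + b * y)] with t ht
  convert ht using 2
  push_cast
  ring

lemma eq_of_forall_generic {F G : ℂ × ℂ → ℂ} {w : ℂ} (hw : theta1 τ w ≠ 0)
    (hF : ContinuousAt F (h, y)) (hG : ContinuousAt G (h, y))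
    (hFG : ∀ h' y', Generic τ h' y' → F (h', y') = G (h', y')) : F (h, y) = G (h, y) := by
  have path : Tendsto (fun t : ℂ => (h + t, y + 9 * t)) (𝓝[≠] 0) (𝓝 (h, y)) :=
    (Continuous.tendsto' (by fun_prop) 0 _ (by simp)).mono_left nhdsWithin_le_nhds
  exact tendsto_nhds_unique_of_eventuallyEq (hF.tendsto.comp path) (hG.tendsto.comp path)
    ((eventually_generic hw h y).mono fun t ht => hFG _ _ ht)

lemma continuousAt_num (h6 : theta1 τ (6 * h) ≠ 0) (hy : theta1 τ (2 * y) ≠ 0) (x : ℂ) :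
    ContinuousAt (fun p : ℂ × ℂ => num τ p.1 p.2 x) (h, y) := by
  have hy_neg : theta1 τ (2 * -y) ≠ 0 := by rwa [mul_neg, theta1_neg, neg_ne_zero]
  unfold num numTerm coeffU poleFactor
  fun_prop (disch := assumption)

lemma continuous_den (τ : UpperHalfPlane) (x : ℂ) :
    Continuous fun p : ℂ × ℂ => den τ p.1 p.2 x := by
  unfold den poleFactor
  fun_prop

lemma continuousAt_K (hh : ∀ n ∈ ({2, 3, 4, 5, 6} : Finset ℕ), theta1 τ (n * h) ≠ 0) :
    ContinuousAt (K τ) h := by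
  simp only [Finset.forall_mem_insert, Finset.mem_singleton, forall_eq, Nat.cast_ofNat] at hh
  obtain ⟨h2, h3, h4, h5, h6⟩ := hh
  have h65 := mul_ne_zero h6 h5
  have h43 := mul_ne_zero h4 h3
  have h54 := mul_ne_zero h5 h4
  have h32 := mul_ne_zero h3 h2
  unfold K
  fun_prop (disch := assumption)

lemma num_eq_K_mul_den (hh : ∀ n ∈ ({2, 3, 4, 5, 6} : Finset ℕ), theta1 τ (n * h) ≠ 0)
    (hy : theta1 τ (2 * y) ≠ 0) (x : ℂ) : num τ h y x = K τ h * den τ h y x := by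
  have h6 : theta1 τ (6 * h) ≠ 0 := by simpa using hh 6 (by simp)
  exact eq_of_forall_generic h6 (continuousAt_num h6 hy x)
    ((continuousAt_K hh).fst'.mul (continuous_den τ x).continuousAt) fun _ _ hg =>
      hg.num_eq_K_mul_den x

lemma signSum_eq_K (hh : ∀ n ∈ ({2, 3, 4, 5, 6} : Finset ℕ), theta1 τ (n * h) ≠ 0)
    (hy : theta1 τ (2 * y) ≠ 0) (hd : den τ h y x ≠ 0) : signSum τ h x y = K τ h :=
  mul_right_cancel₀ hd ((signSum_mul_den hd).trans (num_eq_K_mul_den hh hy x))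

end SignSum

lemma form_neg (lam p : Weight) : form lam (-p) = -form lam p := by
  simp [form, mul_add, add_comm]

lemma form_add (lam p q : Weight) : form lam (p + q) = form lam p + form lam q := by
  simp only [form, Pi.add_apply, mul_add, Finset.sum_add_distrib]

lemma sum_pair_ε {M : Type*} [AddCommMonoid M] (j : Fin 2) (f : Weight → M) :
    ∑ p ∈ ({ε j, -ε j} : Finset Weight), f p = f (ε j) + f (-ε j) :=
  Finset.sum_pair fun h => by simpa [ε, self_eq_neg] using congrFun h j

end C2Theta

end

theorem lemma1 (τ : UpperHalfPlane) (h : ℂ)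
    -- the denominators that depend on `h` only do not vanish
    (hh : ∀ n ∈ ({2, 3, 4, 5, 6} : Finset ℕ), C2Theta.theta1 τ ((n : ℂ) * h) ≠ 0)
    (lam : C2Theta.Weight)
    -- the denominators that depend on `lam` do not vanish
    (hlam : ∀ p ∈ ({C2Theta.ε 0, -C2Theta.ε 0} : Finset C2Theta.Weight),
      ∀ q ∈ ({C2Theta.ε 1, -C2Theta.ε 1} : Finset C2Theta.Weight),
        C2Theta.theta1 τ (2 * C2Theta.form lam p) ≠ 0 ∧
        C2Theta.theta1 τ (2 * C2Theta.form lam q) ≠ 0 ∧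
        C2Theta.theta1 τ (C2Theta.form lam (p + q)) ≠ 0 ∧
        C2Theta.theta1 τ (C2Theta.form lam (p + q) + h) ≠ 0) :
    (∑ p ∈ ({C2Theta.ε 0, -C2Theta.ε 0} : Finset C2Theta.Weight),
      ∑ q ∈ ({C2Theta.ε 1, -C2Theta.ε 1} : Finset C2Theta.Weight),
        C2Theta.U τ h (C2Theta.form lam p) (C2Theta.form lam q))
    - (∑ p ∈ ({C2Theta.ε 0, -C2Theta.ε 0} : Finset C2Theta.Weight),
      ∑ q ∈ ({C2Theta.ε 1, -C2Theta.ε 1} : Finset C2Theta.Weight),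
        (C2Theta.theta1 τ (C2Theta.form lam (p + q) - h) *
          C2Theta.theta1 τ (C2Theta.form lam (p + q) + 2 * h)) /
        (C2Theta.theta1 τ (C2Theta.form lam (p + q)) *
          C2Theta.theta1 τ (C2Theta.form lam (p + q) + h)))
    = C2Theta.K τ h := by
  simp only [C2Theta.sum_pair_ε, Finset.forall_mem_insert, Finset.mem_singleton, forall_eq,
    C2Theta.form_add, C2Theta.form_neg] at hlam ⊢
  set x := C2Theta.form lam (C2Theta.ε 0)
  set y := C2Theta.form lam (C2Theta.ε 1)
  obtain ⟨⟨⟨hx, hy, hpp, hpp'⟩, -, -, hpm, hpm'⟩, ⟨-, -, -, hmp'⟩, -, -, -, hmm'⟩ := hlam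
  have hden : C2Theta.den τ h y x ≠ 0 := by
    rw [C2Theta.den, sub_eq_add_neg, mul_ne_zero_iff, mul_ne_zero_iff,
      C2Theta.poleFactor_ne_zero_iff, C2Theta.poleFactor_ne_zero_iff, neg_add, neg_add, neg_neg]
    exact ⟨hx, ⟨hpp, hpp', hmm'⟩, hpm, hpm', hmp'⟩
  have key := C2Theta.signSum_eq_K hh hy hden
  simp only [C2Theta.signSum, C2Theta.V] at key
  linear_combination key
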